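/- Countable structures are coded as sequences of relations on $\mathbb N$; in particular the space of countable partial orders is the Borel set of all partial orders $R\subseteq\mathbb N\times\mathbb N$. For equivalence relations $E,F$ on standard Borel spaces $X,Y$, $E$ is Borel reducible to $F$ if there is a Borel map $f\colon X\to Y$ (a Borel reduction) with $x\mathrel{E}x'\iff f(x)\mathrel{F}f(x')$. An equivalence relation is Borel complete if it is Borel reducible to the isomorphism relation on some class of countable structures (an isomorphism-invariant Borel set of codes in a countable relational language), and the isomorphism relation on every such class is Borel reducible to it. The generic countable partial order exists: there is a countable partial order that is homogeneous (every isomorphism between finite suborders extends to an automorphism) and into which every finite partial order embeds. Let $\mathcal P$ be such a partial order, and give $\mathrm{Aut}(\mathcal P)$ the Borel structure of pointwise convergence. (1) The isomorphism relation on countable partial orders is Borel reducible to the conjugacy relation on $\mathrm{Aut}(\mathcal P)$. Moreover, a Borel reduction $R\mapsto\varphi_R$ can be chosen so that $R$ is recovered from the antichain orbits of $\varphi_R$: for every $R$, the set of those $\varphi_R$-orbits that are antichains in $\mathcal P$, with the relation $O\le O'$ iff $x\le y$ for some $x\in O$ and $y\in O'$, is isomorphic to $(\mathbb N,R)$. (2)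 The conjugacy relation on $\mathrm{Aut}(\mathcal P)$ is Borel complete. -/

import Mathlib

/-! Borel reducibility of equivalence relations on standard Borel spaces -/

/-- `f` is a Borel reduction of the equivalence relation `E` to the equivalence relation `F`. -/
def IsBorelReduction {X Y : Type*} [MeasurableSpace X] [StandardBorelSpace X]
    [MeasurableSpace Y] [StandardBorelSpace Y] (E : Setoid X) (F : Setoid Y) (f : X → Y) : Prop :=
  Measurable f ∧ ∀ x x' : X, E x x' ↔ F (f x) (f x')

/-- `E` is Borel reducible to `F`. -/
def BorelReducible {X Y : Type*} [MeasurableSpace X] [StandardBorelSpace X]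
    [MeasurableSpace Y] [StandardBorelSpace Y] (E : Setoid X) (F : Setoid Y) : Prop :=
  ∃ f : X → Y, IsBorelReduction E F f

/-! Countable structures coded by relations on `ℕ`, and Borel completeness -/

/-- The space of countable structures, with domain `ℕ`, in the relational language with one
relation symbol of arity `ar i` for each `i : ι`. It carries the product σ-algebra. -/
abbrev CodedStructure {ι : Type} (ar : ι → ℕ) : Type :=
  (i : ι) → (Fin (ar i) → ℕ) → Prop

/-- Isomorphism of coded structures. -/
def CodedStructure.iso {ι : Type} (ar : ι → ℕ) : Setoid (CodedStructure ar) where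
  r A B := ∃ σ : ℕ ≃ ℕ, ∀ (i : ι) (v : Fin (ar i) → ℕ), A i v ↔ B i (fun j => σ (v j))
  iseqv :=
    { refl := fun _ => ⟨Equiv.refl ℕ, fun _ _ => Iff.rfl⟩
      symm := by
        rintro A B ⟨σ, h⟩
        refine ⟨σ.symm, fun i v => ?_⟩
        simp [h]
      trans := by
        rintro A B C ⟨σ, h⟩ ⟨τ, k⟩
        refine ⟨σ.trans τ, fun i v => ?_⟩
        simp [h, k] }

/-- A (Borel, isomorphism-invariant) class of countable structures. -/
structure StructureClass {ι : Type} (ar : ι → ℕ) where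
  /-- The codes of the members of the class. -/
  carrier : Set (CodedStructure ar)
  borel : MeasurableSet carrier
  invariant : ∀ A B : CodedStructure ar, CodedStructure.iso ar A B → A ∈ carrier → B ∈ carrier

instance StructureClass.standardBorelSpace {ι : Type} [Countable ι] {ar : ι → ℕ}
    (C : StructureClass ar) : StandardBorelSpace C.carrier :=
  C.borel.standardBorel

/-- The isomorphism relation on a class of countable structures. -/
def StructureClass.iso {ι : Type} {ar : ι → ℕ} (C : StructureClass ar) : Setoid C.carrier :=
  (CodedStructure.iso ar).comap Subtype.val

/-- `E` is Borel complete: it is Borel reducible to the isomorphism relation on some class of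
countable structures, and the isomorphism relation on every class of countable structures is Borel
reducible to it. -/
def BorelComplete {X : Type*} [MeasurableSpace X] [StandardBorelSpace X] (E : Setoid X) : Prop :=
  (∃ (ι : Type) (_ : Countable ι) (ar : ι → ℕ) (C : StructureClass ar),
    BorelReducible E C.iso) ∧
  (∀ (ι : Type) [Countable ι] (ar : ι → ℕ) (C : StructureClass ar),
    BorelReducible C.iso E)

/-! Countable partial orders -/

/-- The space of partial orders on `ℕ`, a Borel subset of the space of binary relations. -/
abbrev CountablePartialOrder : Type :=
  {r : ℕ → ℕ → Prop // IsPartialOrder ℕ r}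

theorem measurableSet_isPartialOrder :
    MeasurableSet {r : ℕ → ℕ → Prop | IsPartialOrder ℕ r} := by
  have hm : ∀ a b : ℕ, Measurable fun r : ℕ → ℕ → Prop => r a b := fun a b =>
    (measurable_pi_apply b).comp (measurable_pi_apply a)
  have h : {r : ℕ → ℕ → Prop | IsPartialOrder ℕ r} =
      {r | (∀ a, r a a) ∧ (∀ a b c, r a b → r b c → r a c) ∧ ∀ a b, r a b → r b a → a = b} := by
    ext r
    constructor
    · intro h
      exact ⟨h.refl, h.trans, h.antisymm⟩
    · rintro ⟨h1, h2, h3⟩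
      exact { refl := h1, trans := h2, antisymm := h3 }
  rw [h]
  apply measurableSet_setOfPred.2
  refine Measurable.and ?_ (Measurable.and ?_ ?_)
  · exact Measurable.forall fun a => hm a a
  · exact Measurable.forall fun a => Measurable.forall fun b => Measurable.forall fun c =>
      (hm a b).imp ((hm b c).imp (hm a c))
  · exact Measurable.forall fun a => Measurable.forall fun b =>
      (hm a b).imp ((hm b a).imp measurable_const)

instance CountablePartialOrder.standardBorelSpace : StandardBorelSpace CountablePartialOrder :=
  measurableSet_isPartialOrder.standardBorel

/-- The isomorphism relation on countable partial orders. -/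
def CountablePartialOrder.iso : Setoid CountablePartialOrder where
  r R S := Nonempty (R.1 ≃r S.1)
  iseqv :=
    { refl := fun R => ⟨RelIso.refl R.1⟩
      symm := fun ⟨e⟩ => ⟨e.symm⟩
      trans := fun ⟨e⟩ ⟨e'⟩ => ⟨e.trans e'⟩ }

/-! The generic partial order and its automorphism group -/

/-- A countable partial order with this property is the generic partial order, the Fraïssé limit of
the finite partial orders: it is homogeneous, and every finite partial order embeds in it. -/
structure IsGenericPartialOrder (P : Type*) [PartialOrder P] : Prop where
  homogeneous : ∀ (s : Finset P) (f : s ↪o P), ∃ g : P ≃o P, ∀ x : s, g x = f x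
  universal : ∀ (F : Type) [PartialOrder F] [Finite F], Nonempty (F ↪o P)

/-- The σ-algebra on the automorphism group generated by the evaluation maps. For countable `P` it
is the Borel σ-algebra of the topology of pointwise convergence (with `P` discrete). -/
instance OrderIso.evalMeasurableSpace (P : Type*) [PartialOrder P] : MeasurableSpace (P ≃o P) :=
  MeasurableSpace.comap (fun φ x => φ x) (@MeasurableSpace.pi P (fun _ => P) (fun _ => ⊤))

instance OrderIso.evalStandardBorelSpace (P : Type*) [PartialOrder P] [Countable P] :
    StandardBorelSpace (P ≃o P) := by
  let _ : MeasurableSpace P := ⊤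
  have : DiscreteMeasurableSpace P := ⟨fun _ => trivial⟩
  let S : Set ((P → P) × (P → P)) :=
    {p | (∀ x, p.2 (p.1 x) = x) ∧ (∀ x, p.1 (p.2 x) = x) ∧ ∀ x y, p.1 x ≤ p.1 y ↔ x ≤ y}
  have m1 : ∀ x, Measurable fun p : (P → P) × (P → P) => p.1 x := fun x =>
    (measurable_pi_apply x).comp measurable_fst
  have m2 : ∀ x, Measurable fun p : (P → P) × (P → P) => p.2 x := fun x =>
    (measurable_pi_apply x).comp measurable_snd
  have ms : ∀ (x y : P), MeasurableSet {p : (P → P) × (P → P) | p.1 x = y} := fun x y =>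
    m1 x (MeasurableSet.of_discrete (s := {y}))
  have mt : ∀ (x y : P), MeasurableSet {p : (P → P) × (P → P) | p.2 x = y} := fun x y =>
    m2 x (MeasurableSet.of_discrete (s := {y}))
  have hS : MeasurableSet S := by
    have e : S = {p | (∀ x y, p.1 x = y → p.2 y = x) ∧ (∀ x y, p.2 x = y → p.1 y = x) ∧
        ∀ x y a b, p.1 x = a → p.1 y = b → (a ≤ b ↔ x ≤ y)} := by
      ext p
      simp [S]
    rw [e]
    apply measurableSet_setOfPred.2
    refine Measurable.and ?_ (Measurable.and ?_ ?_)
    · exact Measurable.forall fun x => Measurable.forall fun y =>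
        (measurableSet_setOfPred.1 (ms x y)).imp (measurableSet_setOfPred.1 (mt y x))
    · exact Measurable.forall fun x => Measurable.forall fun y =>
        (measurableSet_setOfPred.1 (mt x y)).imp (measurableSet_setOfPred.1 (ms y x))
    · exact Measurable.forall fun x => Measurable.forall fun y => Measurable.forall fun a =>
        Measurable.forall fun b => (measurableSet_setOfPred.1 (ms x a)).imp
          ((measurableSet_setOfPred.1 (ms y b)).imp measurable_const)
  have : StandardBorelSpace S := hS.standardBorel
  have hev : ∀ x, Measurable fun φ : P ≃o P => φ x := fun x =>
    (measurable_pi_apply x).comp (comap_measurable (fun (φ : P ≃o P) x => φ x))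
  have hinv : ∀ x, Measurable fun φ : P ≃o P => φ.symm x := by
    intro x
    refine measurable_to_countable' fun y => ?_
    have : (fun φ : P ≃o P => φ.symm x) ⁻¹' {y} = (fun φ : P ≃o P => φ y) ⁻¹' {x} := by
      ext φ
      simp only [Set.mem_preimage, Set.mem_singleton_iff]
      rw [OrderIso.symm_apply_eq]
      exact eq_comm
    rw [this]
    exact hev y MeasurableSet.of_discrete
  have hmem : ∀ φ : P ≃o P, ((fun x => φ x, fun x => φ.symm x) : (P → P) × (P → P)) ∈ S :=
    fun φ => by simp [S]
  let e : (P ≃o P) ≃ᵐ S :=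
    { toFun := fun φ => ⟨(fun x => φ x, fun x => φ.symm x), hmem φ⟩
      invFun := fun p =>
        { toFun := p.1.1
          invFun := p.1.2
          left_inv := p.2.1
          right_inv := p.2.2.1
          map_rel_iff' := fun {x y} => p.2.2.2 x y }
      left_inv := fun φ => by ext x; rfl
      right_inv := fun p => rfl
      measurable_toFun := Measurable.subtype_mk (h := hmem)
        ((measurable_pi_iff.2 hev).prodMk (measurable_pi_iff.2 hinv))
      measurable_invFun := by
        refine measurable_comap_iff.2 ?_
        exact measurable_fst.comp measurable_subtype_coe }
  obtain ⟨t, hb, hp⟩ := StandardBorelSpace.polish (α := S)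
  let τ : TopologicalSpace (P ≃o P) := t.induced e.toEquiv
  refine ⟨τ, ⟨?_⟩, e.toEquiv.polishSpace_induced⟩
  have h1 : borel (P ≃o P) = (borel S).comap e := borel_comap
  rw [h1, ← hb.measurable_eq]
  exact e.measurableEmbedding.comap_eq.symm

/-- The orbit of `x` under the automorphism `φ`. -/
def autOrbit {P : Type*} [PartialOrder P] (φ : P ≃o P) (x : P) : Set P :=
  Set.range fun n : ℤ => (φ ^ n) x

/-- The orbits of `φ` that are antichains. -/
abbrev AntichainOrbit {P : Type*} [PartialOrder P] (φ : P ≃o P) : Type _ :=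
  {O : Set P // (∃ x, O = autOrbit φ x) ∧ IsAntichain (· ≤ ·) O}

/-- The relation that the order of `P` induces on the antichain orbits of `φ`. -/
def antichainOrbitLE {P : Type*} [PartialOrder P] (φ : P ≃o P) (O O' : AntichainOrbit φ) : Prop :=
  ∃ x ∈ O.1, ∃ y ∈ O'.1, x ≤ y

/-! For a countable partial order, being generic is equivalent to the one-point extension property
`HasExtensions`. Genericity yields extensions by embedding a one-point extension of a finite
suborder and moving it into place by homogeneity; back and forth gives the converse. Back and forth
also identifies any two countable orders with this property.

For the reduction, each partial order `R` on `ℕ` is enlarged freely to an order on `OrbitTerm` with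
the extension property and with an automorphism, the shift. Base points are fixed by the shift and
carry `R`. Every other term `x` lies strictly below its own shift, so its orbit is not an antichain.
Hence the antichain orbits are exactly the fixed points, and they form a copy of `R`. A conjugacy
maps fixed points to fixed points and so gives an isomorphism of the base orders; conversely an
isomorphism of base orders renames terms, and renaming commutes with the shift.

The set of terms does not depend on `R`; only the order `Le R` does, and each instance of it is a
Borel condition on `R`. Back and forth that always takes the least admissible choice then identifies
`(OrbitTerm, Le R)` with `P` in a Borel way, which makes the reduction Borel.

For Borel completeness, an automorphism is coded by its graph together with the order of `P`, and
arbitrary structures are coded by partial orders (`CodePoint`). There the number of markers below a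
point records its role: even for coordinate points of elements, odd for tuples in a relation. An
order isomorphism preserves these numbers, so it recovers the structure. -/

/-! ### Extension property and measurable back and forth -/

/-- The one-point extension property of the generic partial order. -/
def HasExtensions {α : Type*} (r : α → α → Prop) : Prop :=
  ∀ A B C : Set α, A.Finite → B.Finite → C.Finite →
    (∀ a ∈ A, ∀ b ∈ B, r a b ∧ a ≠ b) → (∀ a ∈ A, ∀ c ∈ C, ¬ r c a) →
    (∀ b ∈ B, ∀ c ∈ C, ¬ r b c) →
    ∃ x, (∀ a ∈ A, r a x ∧ a ≠ x) ∧ (∀ b ∈ B, r x b ∧ x ≠ b) ∧ ∀ c ∈ C, ¬ r c x ∧ ¬ r x c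

/-- A finite list of pairs that preserves and reflects the relations. -/
def IsPartialIso {α β : Type*} (r : α → α → Prop) (s : β → β → Prop) (l : List (α × β)) : Prop :=
  ∀ u ∈ l, ∀ v ∈ l, r u.1 v.1 ↔ s u.2 v.2

theorem isPartialIso_map_swap {α β : Type*} {r : α → α → Prop} {s : β → β → Prop}
    {l : List (α × β)} : IsPartialIso s r (l.map Prod.swap) ↔ IsPartialIso r s l := by
  simp only [IsPartialIso, List.forall_mem_map, Prod.fst_swap, Prod.snd_swap]
  exact forall₂_congr fun _ _ => forall₂_congr fun _ _ => Iff.comm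

/-- If `t` is not yet in the domain, the images of the points below, above and incomparable to `t`
form finite sets `A`, `B`, `C` as in `HasExtensions`. Transitivity gives the conditions on them, and
the freshness of `t` gives strictness between `A` and `B`. -/
theorem IsPartialIso.exists_cons {α β : Type*} {r : α → α → Prop} {s : β → β → Prop}
    (hr : IsPartialOrder α r) (hs : IsPartialOrder β s) (es : HasExtensions s)
    {l : List (α × β)} (h : IsPartialIso r s l) (t : α) :
    ∃ p, IsPartialIso r s ((t, p) :: l) := by
  by_cases ht : ∃ p, (t, p) ∈ l
  · obtain ⟨p, hp⟩ := ht
    refine ⟨p, fun u hu v hv => h u ?_ v ?_⟩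
    · rcases List.mem_cons.1 hu with rfl | hu
      exacts [hp, hu]
    · rcases List.mem_cons.1 hv with rfl | hv
      exacts [hp, hv]
  push Not at ht
  have hfin : ∀ q : α → Prop, {p : β | ∃ a, (a, p) ∈ l ∧ q a}.Finite := fun q =>
    ((List.finite_toSet l).image Prod.snd).subset (by
      rintro p ⟨a, ha, -⟩
      exact ⟨(a, p), ha, rfl⟩)
  obtain ⟨x, hA, hB, hC⟩ := es {p | ∃ a, (a, p) ∈ l ∧ r a t} {p | ∃ a, (a, p) ∈ l ∧ r t a}
    {p | ∃ a, (a, p) ∈ l ∧ (¬ r a t ∧ ¬ r t a)} (hfin _) (hfin _) (hfin _)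
    (by
      rintro p ⟨a, ha, hat⟩ q ⟨b, hb, htb⟩
      refine ⟨(h _ ha _ hb).1 (hr.trans _ _ _ hat htb), ?_⟩
      rintro rfl
      have hba : r b a := (h _ hb _ ha).2 (hs.refl p)
      have : a = t := hr.antisymm _ _ hat (hr.trans _ _ _ htb hba)
      exact ht p (this ▸ ha))
    (by
      rintro p ⟨a, ha, hat⟩ q ⟨c, hc, hct, -⟩ hqp
      exact hct (hr.trans _ _ _ ((h _ hc _ ha).2 hqp) hat))
    (by
      rintro p ⟨b, hb, htb⟩ q ⟨c, hc, -, htc⟩ hpq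
      exact htc (hr.trans _ _ _ htb ((h _ hb _ hc).2 hpq)))
  have key : ∀ a p, (a, p) ∈ l → (r a t ↔ s p x) ∧ (r t a ↔ s x p) := by
    intro a p hap
    refine ⟨⟨fun hat => (hA p ⟨a, hap, hat⟩).1, fun hpx => ?_⟩,
      ⟨fun hta => (hB p ⟨a, hap, hta⟩).1, fun hxp => ?_⟩⟩
    · by_contra hat
      by_cases hta : r t a
      · have := hB p ⟨a, hap, hta⟩
        exact this.2 (hs.antisymm _ _ this.1 hpx)
      · exact (hC p ⟨a, hap, hat, hta⟩).1 hpx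
    · by_contra hta
      by_cases hat : r a t
      · have := hA p ⟨a, hap, hat⟩
        exact this.2 (hs.antisymm _ _ this.1 hxp)
      · exact (hC p ⟨a, hap, hat, hta⟩).2 hxp
  refine ⟨x, fun u hu v hv => ?_⟩
  rcases List.mem_cons.1 hu with rfl | hu <;> rcases List.mem_cons.1 hv with rfl | hv
  · exact ⟨fun _ => hs.refl x, fun _ => hr.refl t⟩
  · exact (key v.1 v.2 hv).2
  · exact (key u.1 u.2 hu).1
  · exact h u hu v hv

theorem IsPartialIso.exists_cons' {α β : Type*} {r : α → α → Prop} {s : β → β → Prop}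
    (hr : IsPartialOrder α r) (hs : IsPartialOrder β s) (er : HasExtensions r)
    {l : List (α × β)} (h : IsPartialIso r s l) (p : β) :
    ∃ t, IsPartialIso r s ((t, p) :: l) := by
  obtain ⟨t, ht⟩ := (isPartialIso_map_swap.2 h).exists_cons hs hr er p
  exact ⟨t, isPartialIso_map_swap.1 ht⟩

section BackAndForth

variable {X α β : Type*} (r : X → α → α → Prop) (s : β → β → Prop)
  (a : ℕ → α) (b : ℕ → β) (c : ℕ → β × α)

/-- Extend a partial isomorphism so that `a n` is in its domain and `b n` in its range. -/
def backAndForthStep (n : ℕ) (l : List (α × β)) (k : ℕ) : List (α × β) :=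
  (a n, (c k).1) :: ((c k).2, b n) :: l

/-- The finite stages of the back-and-forth construction, which always uses the first
possible extension. -/
noncomputable def backAndForthStage (l₀ : List (α × β)) : ℕ → X → List (α × β)
  | 0, _ => l₀
  | n + 1, x => backAndForthStep a b c n (backAndForthStage l₀ n x)
      (sInf {k | IsPartialIso (r x) s
        (backAndForthStep a b c n (backAndForthStage l₀ n x) k)})

variable {r s a b c}

theorem exists_backAndForthStep (hc : c.Surjective) {x : X}
    (hr : IsPartialOrder α (r x)) (hs : IsPartialOrder β s)
    (er : HasExtensions (r x)) (es : HasExtensions s) (n : ℕ) {l : List (α × β)}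
    (h : IsPartialIso (r x) s l) :
    {k | IsPartialIso (r x) s (backAndForthStep a b c n l k)}.Nonempty := by
  obtain ⟨t, ht⟩ := h.exists_cons' hr hs er (b n)
  obtain ⟨p, hp⟩ := ht.exists_cons hr hs es (a n)
  obtain ⟨k, hk⟩ := hc (p, t)
  exact ⟨k, by simpa [backAndForthStep, hk] using hp⟩

theorem isPartialIso_backAndForthStage (hc : c.Surjective) {x : X}
    (hr : IsPartialOrder α (r x)) (hs : IsPartialOrder β s)
    (er : HasExtensions (r x)) (es : HasExtensions s) {l₀ : List (α × β)}
    (h₀ : IsPartialIso (r x) s l₀) (n : ℕ) :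
    IsPartialIso (r x) s (backAndForthStage r s a b c l₀ n x) := by
  induction n with
  | zero => exact h₀
  | succ n ih => exact Nat.sInf_mem (exists_backAndForthStep hc hr hs er es n ih)

theorem backAndForthStage_subset_succ (l₀ : List (α × β)) (n : ℕ) (x : X) :
    backAndForthStage r s a b c l₀ n x ⊆ backAndForthStage r s a b c l₀ (n + 1) x := by
  rw [backAndForthStage]
  exact fun u hu => List.mem_cons_of_mem _ (List.mem_cons_of_mem _ hu)

theorem backAndForthStage_mono (l₀ : List (α × β)) (x : X) {m n : ℕ} (h : m ≤ n) :
    backAndForthStage r s a b c l₀ m x ⊆ backAndForthStage r s a b c l₀ n x := by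
  induction n, h using Nat.le_induction with
  | base => exact List.Subset.refl _
  | succ n _ ih => exact List.Subset.trans ih (backAndForthStage_subset_succ l₀ n x)

theorem measurableSet_isPartialIso [MeasurableSpace X]
    (hm : ∀ a b, MeasurableSet {x | r x a b}) (l : List (α × β)) :
    MeasurableSet {x | IsPartialIso (r x) s l} := by
  have : {x | IsPartialIso (r x) s l} =
      ⋂ u ∈ {u | u ∈ l}, ⋂ v ∈ {v | v ∈ l}, {x | r x u.1 v.1 ↔ s u.2 v.2} := by
    ext x
    simp [IsPartialIso]
  rw [this]
  have hl : {u | u ∈ l}.Countable := (List.finite_toSet l).countable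
  refine MeasurableSet.biInter hl fun u _ => MeasurableSet.biInter hl fun v _ => ?_
  exact measurableSet_setOfPred.2
    ((measurableSet_setOfPred.1 (hm u.1 v.1)).iff measurable_const)

/-- Since the least admissible index is chosen, reaching a given list is a countable combination of
conditions that certain lists are, or are not, partial isomorphisms, and each of these involves
finitely many instances of `r x`. -/
theorem measurableSet_backAndForthStage [MeasurableSpace X] [Countable α] [Countable β]
    (hc : c.Surjective) (hr : ∀ x, IsPartialOrder α (r x)) (hs : IsPartialOrder β s)
    (er : ∀ x, HasExtensions (r x)) (es : HasExtensions s)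
    (hm : ∀ a b, MeasurableSet {x | r x a b}) {l₀ : List (α × β)}
    (h₀ : ∀ x, IsPartialIso (r x) s l₀) (n : ℕ) (l : List (α × β)) :
    MeasurableSet {x | backAndForthStage r s a b c l₀ n x = l} := by
  induction n generalizing l with
  | zero => exact MeasurableSet.const (l₀ = l)
  | succ n ih =>
    have : {x | backAndForthStage r s a b c l₀ (n + 1) x = l} =
        ⋃ (l' : List (α × β)), ⋃ (k : ℕ), ({x | backAndForthStage r s a b c l₀ n x = l'} ∩
          ({x | IsPartialIso (r x) s (backAndForthStep a b c n l' k)} ∩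
          ⋂ (j : ℕ), {x | j < k → ¬ IsPartialIso (r x) s (backAndForthStep a b c n l' j)})) ∩
          {_x | backAndForthStep a b c n l' k = l} := by
      ext x
      simp only [Set.mem_iUnion, Set.mem_inter_iff, Set.mem_ofPred_eq, Set.mem_iInter]
      have hne := exists_backAndForthStep (a := a) (b := b) hc (hr x) hs (er x) es n
        (isPartialIso_backAndForthStage (a := a) (b := b) hc (hr x) hs (er x) es (h₀ x) n)
      constructor
      · intro h
        exact ⟨_, _, ⟨rfl, Nat.sInf_mem hne, fun j hj => Nat.notMem_of_lt_sInf hj⟩, h⟩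
      · rintro ⟨l', k, ⟨rfl, hk, hlt⟩, rfl⟩
        rw [backAndForthStage]
        congr 1
        refine le_antisymm (Nat.sInf_le hk) (not_lt.1 fun hlt' => hlt _ hlt' ?_)
        exact Nat.sInf_mem hne
    rw [this]
    refine MeasurableSet.iUnion fun l' => MeasurableSet.iUnion fun k =>
      ((ih l').inter ((measurableSet_isPartialIso hm _).inter
        (MeasurableSet.iInter fun j => ?_))).inter (MeasurableSet.const _)
    exact measurableSet_setOfPred.2 (measurable_const.imp
      (measurableSet_setOfPred.1 (measurableSet_isPartialIso hm _)).not)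

end BackAndForth

/-- Back and forth, uniformly measurable in a parameter. -/
theorem exists_measurable_equiv {X α β : Type*} [MeasurableSpace X] [Countable α] [Countable β]
    [Nonempty α] [Nonempty β] {r : X → α → α → Prop} {s : β → β → Prop}
    (hr : ∀ x, IsPartialOrder α (r x)) (hs : IsPartialOrder β s)
    (er : ∀ x, HasExtensions (r x)) (es : HasExtensions s)
    (hm : ∀ a b, MeasurableSet {x | r x a b}) {l₀ : List (α × β)}
    (h₀ : ∀ x, IsPartialIso (r x) s l₀) :
    ∃ e : X → α ≃ β, (∀ x a b, r x a b ↔ s (e x a) (e x b)) ∧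
      (∀ x, ∀ u ∈ l₀, e x u.1 = u.2) ∧ ∀ a b, MeasurableSet {x | e x a = b} := by
  obtain ⟨a, ha⟩ := exists_surjective_nat α
  obtain ⟨b, hb⟩ := exists_surjective_nat β
  obtain ⟨c, hc⟩ := exists_surjective_nat (β × α)
  set S := backAndForthStage r s a b c l₀ with hS
  have iso : ∀ x u v, (∃ n, u ∈ S n x) → (∃ n, v ∈ S n x) → (r x u.1 v.1 ↔ s u.2 v.2) := by
    rintro x u v ⟨m, hu⟩ ⟨n, hv⟩
    exact isPartialIso_backAndForthStage hc (hr x) hs (er x) es (h₀ x) (max m n)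
      u (backAndForthStage_mono l₀ x (le_max_left m n) hu)
      v (backAndForthStage_mono l₀ x (le_max_right m n) hv)
  have uniq_right : ∀ x t p q, (∃ n, (t, p) ∈ S n x) → (∃ n, (t, q) ∈ S n x) → p = q :=
    fun x t p q hp hq => hs.antisymm _ _ ((iso x (t, p) (t, q) hp hq).1 ((hr x).refl t))
      ((iso x (t, q) (t, p) hq hp).1 ((hr x).refl t))
  have uniq_left : ∀ x t u p, (∃ n, (t, p) ∈ S n x) → (∃ n, (u, p) ∈ S n x) → t = u :=
    fun x t u p ht hu => (hr x).antisymm _ _ ((iso x (t, p) (u, p) ht hu).2 (hs.refl p))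
      ((iso x (u, p) (t, p) hu ht).2 (hs.refl p))
  have total_left : ∀ x t, ∃ p, ∃ n, (t, p) ∈ S n x := by
    intro x t
    obtain ⟨n, rfl⟩ := ha t
    exact ⟨_, n + 1, List.mem_cons_self⟩
  have total_right : ∀ x p, ∃ t, ∃ n, (t, p) ∈ S n x := by
    intro x p
    obtain ⟨n, rfl⟩ := hb p
    exact ⟨_, n + 1, List.mem_cons_of_mem _ List.mem_cons_self⟩
  choose f hf using total_left
  choose g hg using total_right
  refine ⟨fun x => ⟨f x, g x, fun t => uniq_left x _ _ _ (hg x (f x t)) (hf x t),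
    fun p => uniq_right x _ _ _ (hf x (g x p)) (hg x p)⟩,
    fun x t u => iso x (t, f x t) (u, f x u) (hf x t) (hf x u),
    fun x u hu => uniq_right x u.1 _ _ (hf x u.1) ⟨0, hu⟩, fun t p => ?_⟩
  have : {x | f x t = p} = ⋃ n, ⋃ l, {x | S n x = l} ∩ {_x | (t, p) ∈ l} := by
    ext x
    simp only [Set.mem_ofPred_eq, Set.mem_iUnion, Set.mem_inter_iff, exists_eq_left']
    exact ⟨fun h => h ▸ hf x t, fun h => uniq_right x t _ _ (hf x t) h⟩
  change MeasurableSet {x | f x t = p}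
  rw [this]
  exact MeasurableSet.iUnion fun n => MeasurableSet.iUnion fun l =>
    (measurableSet_backAndForthStage hc hr hs er es hm h₀ n l).inter (MeasurableSet.const _)

/-! ### Genericity and the extension property -/

theorem isPartialOrder_le (P : Type*) [PartialOrder P] :
    IsPartialOrder P (fun x y : P => x ≤ y) where
  refl := le_refl
  trans _ _ _ := le_trans
  antisymm _ _ := le_antisymm

theorem HasExtensions.isGenericPartialOrder {P : Type*} [PartialOrder P] [Countable P]
    (h : HasExtensions fun x y : P => x ≤ y) : IsGenericPartialOrder P where
  homogeneous s f := by
    obtain ⟨x, -⟩ := h ∅ ∅ ∅ Set.finite_empty Set.finite_empty Set.finite_empty (by simp)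
      (by simp) (by simp)
    have : Nonempty P := ⟨x⟩
    obtain ⟨e, he, hl, -⟩ := exists_measurable_equiv (X := Unit) (r := fun _ (x y : P) => x ≤ y)
      (s := fun x y : P => x ≤ y)
      (fun _ => isPartialOrder_le P) (isPartialOrder_le P) (fun _ => h) h
      (fun _ _ => MeasurableSet.const _) (l₀ := s.attach.toList.map fun y : s => ((y : P), f y))
      (fun _ => by
        simp only [IsPartialIso, List.forall_mem_map]
        intro y _ z _
        exact f.le_iff_le.symm)
    refine ⟨⟨e (), fun {x y} => (he () x y).symm⟩, fun y => ?_⟩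
    exact hl () (y, f y) (List.mem_map.2 ⟨y, by simp, rfl⟩)
  universal F _ _ := by
    -- Only the "forth" half is available, as a finite order `F` need not have extensions.
    have hl : ∀ l : List F, ∃ L : List (F × P),
        IsPartialIso (fun x y : F => x ≤ y) (fun x y : P => x ≤ y) L ∧ ∀ t ∈ l, ∃ p, (t, p) ∈ L := by
      intro l
      induction l with
      | nil => exact ⟨[], by simp [IsPartialIso], by simp⟩
      | cons t l ih =>
        obtain ⟨L, hL, hl⟩ := ih
        obtain ⟨p, hp⟩ := hL.exists_cons (isPartialOrder_le F) (isPartialOrder_le P) h t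
        refine ⟨_, hp, fun u hu => ?_⟩
        rcases List.mem_cons.1 hu with rfl | hu
        · exact ⟨p, List.mem_cons_self⟩
        · exact (hl u hu).imp fun q hq => List.mem_cons_of_mem _ hq
    have := Fintype.ofFinite F
    obtain ⟨L, hL, hl⟩ := hl Finset.univ.toList
    choose g hg using fun t => hl t (by simp)
    have hle : ∀ x y, g x ≤ g y ↔ x ≤ y := fun x y => (hL _ (hg x) _ (hg y)).symm
    exact ⟨OrderEmbedding.ofMapLEIff g hle⟩

/-- The relation of the extension of a partial order by one point above `A` and below `B`. -/
def onePointExtensionLE {S : Type*} [PartialOrder S] (A B : Set S) : Option S → Option S → Prop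
  | none, none => True
  | some x, some y => x ≤ y
  | some x, none => ∃ a ∈ A, x ≤ a
  | none, some y => ∃ b ∈ B, b ≤ y

/-- Extension of a partial order by one point that lies above `A` and below `B`. -/
abbrev onePointExtension {S : Type*} [PartialOrder S] (A B : Set S)
    (h : ∀ a ∈ A, ∀ b ∈ B, a < b) : PartialOrder (Option S) where
  le := onePointExtensionLE A B
  lt x y := onePointExtensionLE A B x y ∧ ¬ onePointExtensionLE A B y x
  le_refl
    | none => trivial
    | some x => le_refl x
  le_trans
    | none, none, _ => fun _ h => h
    | none, some _, none => fun _ _ => trivial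
    | none, some _, some _ => fun ⟨b, hb, h1⟩ h2 => ⟨b, hb, le_trans h1 h2⟩
    | some _, none, none => fun h _ => h
    | some _, none, some _ => fun ⟨a, ha, h1⟩ ⟨b, hb, h2⟩ =>
      le_trans h1 (le_trans (h a ha b hb).le h2)
    | some _, some _, none => fun h1 ⟨a, ha, h2⟩ => ⟨a, ha, le_trans h1 h2⟩
    | some _, some _, some _ => fun h1 h2 => le_trans h1 h2
  le_antisymm
    | none, none => fun _ _ => rfl
    | some _, some _ => fun h1 h2 => congrArg some (le_antisymm h1 h2)
    | none, some _ => fun ⟨b, hb, h1⟩ ⟨a, ha, h2⟩ =>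
      absurd (le_trans h1 h2) (h a ha b hb).not_ge
    | some _, none => fun ⟨a, ha, h2⟩ ⟨b, hb, h1⟩ =>
      absurd (le_trans h1 h2) (h a ha b hb).not_ge

/-- Universality speaks of orders in `Type` only; a copy on `Fin n` serves every universe. -/
theorem IsGenericPartialOrder.exists_orderEmbedding {P : Type*} [PartialOrder P]
    (h : IsGenericPartialOrder P) (F : Type*) [PartialOrder F] [Finite F] :
    Nonempty (F ↪o P) := by
  obtain ⟨n, ⟨e⟩⟩ := Finite.exists_equiv_fin F
  let _ : PartialOrder (Fin n) := PartialOrder.lift e.symm e.symm.injective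
  obtain ⟨j⟩ := h.universal (Fin n)
  refine ⟨OrderEmbedding.ofMapLEIff (fun x => j (e x)) fun x y => ?_⟩
  rw [j.le_iff_le]
  change e.symm (e x) ≤ e.symm (e y) ↔ _
  simp

/-- Embed the one-point extension of `S = A ∪ B ∪ C` by universality, then carry the copy of `S`
back onto `S` by an automorphism. The new point lands where it is wanted. -/
theorem IsGenericPartialOrder.hasExtensions {P : Type*} [PartialOrder P]
    (h : IsGenericPartialOrder P) : HasExtensions fun x y : P => x ≤ y := by
  intro A B C hA hB hC hAB hAC hBC
  set S : Set P := A ∪ B ∪ C with hS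
  have hfin : S.Finite := (hA.union hB).union hC
  have : Finite S := hfin
  let A' : Set S := {x | (x : P) ∈ A}
  let B' : Set S := {x | (x : P) ∈ B}
  let _ : PartialOrder (Option S) := onePointExtension A' B' fun a ha b hb =>
    lt_of_le_of_ne (hAB a ha b hb).1 fun e => (hAB a ha b hb).2 (congrArg Subtype.val e)
  obtain ⟨j⟩ := h.exists_orderEmbedding (Option S)
  have hinj : Function.Injective fun x : S => j (some x) := fun x y hxy => by simpa using hxy
  let T : Finset P := (Set.finite_range fun x : S => j (some x)).toFinset
  have hT : ∀ y : T, ∃ x : S, j (some x) = y := fun y =>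
    (Set.finite_range _).mem_toFinset.1 y.2
  choose g hg using hT
  have hgle : ∀ y z : T, (g y : P) ≤ g z ↔ y ≤ z := by
    intro y z
    rw [← Subtype.coe_le_coe (x := y), ← hg y, ← hg z, j.le_iff_le]
    rfl
  obtain ⟨G, hG⟩ := h.homogeneous T (OrderEmbedding.ofMapLEIff (fun y => (g y : P)) hgle)
  have hGj : ∀ x : S, G (j (some x)) = x := by
    intro x
    have hx : j (some x) ∈ T := by simp [T]
    rw [hG ⟨_, hx⟩]
    exact congrArg Subtype.val (hinj (hg ⟨_, hx⟩))
  have ge : ∀ x : S, (x : P) ≤ G (j none) ↔ ∃ a ∈ A', x ≤ a := by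
    intro x
    rw [← hGj x, G.le_iff_le, j.le_iff_le]
    rfl
  have le : ∀ x : S, G (j none) ≤ (x : P) ↔ ∃ b ∈ B', b ≤ x := by
    intro x
    rw [← hGj x, G.le_iff_le, j.le_iff_le]
    rfl
  have ne : ∀ x : S, (x : P) ≠ G (j none) := by
    intro x hx
    rw [← hGj x, G.injective.eq_iff, j.injective.eq_iff] at hx
    cases hx
  refine ⟨G (j none), fun a ha => ?_, fun b hb => ?_, fun c hc => ⟨fun hle => ?_, fun hle => ?_⟩⟩
  · exact ⟨(ge ⟨a, by simp [hS, ha]⟩).2 ⟨_, ha, le_rfl⟩, ne ⟨a, by simp [hS, ha]⟩⟩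
  · exact ⟨(le ⟨b, by simp [hS, hb]⟩).2 ⟨_, hb, le_rfl⟩, (ne ⟨b, by simp [hS, hb]⟩).symm⟩
  · obtain ⟨a, ha, hca⟩ := (ge ⟨c, by simp [hS, hc]⟩).1 hle
    exact hAC a ha c hc hca
  · obtain ⟨b, hb, hbc⟩ := (le ⟨c, by simp [hS, hc]⟩).1 hle
    exact hBC b hb c hc hbc

theorem IsGenericPartialOrder.infinite {P : Type*} [PartialOrder P]
    (h : IsGenericPartialOrder P) : Infinite P := by
  by_contra hP
  rw [not_infinite_iff_finite] at hP
  obtain ⟨j⟩ := h.universal (Fin (Nat.card P + 1))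
  have := Nat.card_le_card_of_injective j j.injective
  simp at this

/-! ### The free extension with its shift automorphism -/

/-- Terms for the elements of the free extension of a partial order on `ℕ` to a generic partial
order with an automorphism. The term `ext p A B z` names a new point above the `A i` and below
the `B j`; the numbers `p` and `z` distinguish points with the same neighbours. -/
inductive OrbitTerm : Type
  | base (k : ℕ) : OrbitTerm
  | ext (p : ℕ) {m n : ℕ} (A : Fin m → OrbitTerm) (B : Fin n → OrbitTerm) (z : ℤ) : OrbitTerm

namespace OrbitTerm

/-- The embedding of the terms into a W-type. -/
def toWType : OrbitTerm →
    WType (α := ℕ ⊕ (ℕ × ℕ × ℕ × ℤ)) (Sum.elim (fun _ => Fin 0 ⊕ Fin 0)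
      fun q => Fin q.2.1 ⊕ Fin q.2.2.1)
  | base k => ⟨Sum.inl k, Sum.elim Fin.elim0 Fin.elim0⟩
  | ext p (m := m) (n := n) A B z => ⟨Sum.inr (p, m, n, z),
      Sum.elim (fun i => toWType (A i)) (fun j => toWType (B j))⟩

theorem toWType_injective : Function.Injective toWType := by
  intro x
  induction x with
  | base k =>
    rintro (l | ⟨p, A, B, z⟩) h
    · injection h with h
      rw [Sum.inl_injective h]
    · injection h with h
      cases h
  | @ext p m n A B z ihA ihB =>
    rintro (l | ⟨p, A', B', z'⟩) h
    · injection h with h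
      cases h
    · injection h with h h'
      simp only [Sum.inr.injEq, Prod.mk.injEq] at h
      obtain ⟨rfl, rfl, rfl, rfl⟩ := h
      have h := eq_of_heq h'
      have hA : A = A' := funext fun i => ihA i (congrFun h (Sum.inl i))
      have hB : B = B' := funext fun j => ihB j (congrFun h (Sum.inr j))
      rw [hA, hB]

instance : Countable OrbitTerm := by
  have : ∀ a : ℕ ⊕ (ℕ × ℕ × ℕ × ℤ), Fintype (Sum.elim (fun _ => Fin 0 ⊕ Fin 0)
      (fun q : ℕ × ℕ × ℕ × ℤ => Fin q.2.1 ⊕ Fin q.2.2.1) a) := by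
    rintro (a | a) <;> dsimp <;> infer_instance
  have : ∀ a : ℕ ⊕ (ℕ × ℕ × ℕ × ℤ), Encodable (Sum.elim (fun _ => Fin 0 ⊕ Fin 0)
      (fun q : ℕ × ℕ × ℕ × ℤ => Fin q.2.1 ⊕ Fin q.2.2.1) a) := by
    rintro (a | a) <;> dsimp <;> infer_instance
  exact toWType_injective.countable

instance : Nonempty OrbitTerm := ⟨base 0⟩

/-- The `k`-th power of the automorphism. -/
def shift (k : ℤ) : OrbitTerm → OrbitTerm
  | base i => base i
  | ext p A B z => ext p (fun i => shift k (A i)) (fun j => shift k (B j)) (z + k)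

theorem shift_zero (x : OrbitTerm) : shift 0 x = x := by
  induction x with
  | base => rfl
  | ext p A B z ihA ihB => simp [shift, ihA, ihB]

theorem shift_shift (k l : ℤ) (x : OrbitTerm) : shift k (shift l x) = shift (l + k) x := by
  induction x with
  | base => rfl
  | ext p A B z ihA ihB => simp [shift, ihA, ihB, add_assoc]

theorem shift_injective (k : ℤ) : Function.Injective (shift k) :=
  Function.LeftInverse.injective (g := shift (-k)) fun x => by
    rw [shift_shift, add_neg_cancel, shift_zero]

/-- Renaming of the base points. -/
def rename (σ : ℕ → ℕ) : OrbitTerm → OrbitTerm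
  | base i => base (σ i)
  | ext p A B z => ext p (fun i => rename σ (A i)) (fun j => rename σ (B j)) z

theorem rename_shift (σ : ℕ → ℕ) (k : ℤ) (x : OrbitTerm) :
    rename σ (shift k x) = shift k (rename σ x) := by
  induction x with
  | base => rfl
  | ext p A B z ihA ihB => simp [shift, rename, ihA, ihB]

theorem rename_rename {σ τ : ℕ → ℕ} (h : Function.LeftInverse τ σ) (x : OrbitTerm) :
    rename τ (rename σ x) = x := by
  induction x with
  | base i => simp [rename, h i]
  | ext p A B z ihA ihB => simp [rename, ihA, ihB]

/-- A complexity measure of terms. -/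
def rank : OrbitTerm → ℕ
  | base _ => 0
  | ext p A B _ => p + 1 + (∑ i, rank (A i) + ∑ j, rank (B j))

theorem rank_shift (k : ℤ) (x : OrbitTerm) : rank (shift k x) = rank x := by
  induction x with
  | base => rfl
  | ext p A B z ihA ihB => simp [shift, rank, ihA, ihB]

theorem rank_left_lt (p : ℕ) {m n : ℕ} (A : Fin m → OrbitTerm) (B : Fin n → OrbitTerm) (z : ℤ)
    (i : Fin m) : rank (A i) < rank (ext p A B z) := by
  have := Finset.single_le_sum (f := fun i => rank (A i)) (fun _ _ => Nat.zero_le _)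
    (Finset.mem_univ i)
  simp only [rank] at this ⊢
  omega

theorem rank_right_lt (p : ℕ) {m n : ℕ} (A : Fin m → OrbitTerm) (B : Fin n → OrbitTerm) (z : ℤ)
    (j : Fin n) : rank (B j) < rank (ext p A B z) := by
  have := Finset.single_le_sum (f := fun j => rank (B j)) (fun _ _ => Nat.zero_le _)
    (Finset.mem_univ j)
  simp only [rank] at this ⊢
  omega

/-- This is why `rank` adds over the neighbours instead of taking a maximum: transitivity and
antisymmetry recurse on a comparison of `A i` with `B j`. -/
theorem rank_left_add_rank_right_lt (p : ℕ) {m n : ℕ} (A : Fin m → OrbitTerm)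
    (B : Fin n → OrbitTerm) (z : ℤ) (i : Fin m) (j : Fin n) :
    rank (A i) + rank (B j) < rank (ext p A B z) := by
  have h1 := Finset.single_le_sum (f := fun i => rank (A i)) (fun _ _ => Nat.zero_le _)
    (Finset.mem_univ i)
  have h2 := Finset.single_le_sum (f := fun j => rank (B j)) (fun _ _ => Nat.zero_le _)
    (Finset.mem_univ j)
  simp only [rank] at h1 h2 ⊢
  omega

/-- The order on terms generated by the order `R` of the base points. The relation of
`ext p A B z` to `B j` is void unless `B j` is above all `A i`. -/
inductive Le (R : ℕ → ℕ → Prop) : OrbitTerm → OrbitTerm → Prop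
  | base {i j : ℕ} (h : R i j) : Le R (base i) (base j)
  | shift {x y : OrbitTerm} (k : ℤ) (hk : 0 ≤ k) (h : y = shift k x) : Le R x y
  | left {p m n : ℕ} {A : Fin m → OrbitTerm} {B : Fin n → OrbitTerm} {z : ℤ} {y : OrbitTerm}
      (j : Fin n) (hle : ∀ i, Le R (A i) (B j)) (hne : ∀ i, A i ≠ B j) (h : Le R (B j) y) :
      Le R (ext p A B z) y
  | right {p m n : ℕ} {A : Fin m → OrbitTerm} {B : Fin n → OrbitTerm} {z : ℤ} {x : OrbitTerm}
      (i : Fin m) (h : Le R x (A i)) : Le R x (ext p A B z)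

variable {R : ℕ → ℕ → Prop}

theorem Le.refl (x : OrbitTerm) : Le R x x := .shift 0 le_rfl (shift_zero x).symm

theorem Le.map_shift {x y : OrbitTerm} (h : Le R x y) (k : ℤ) :
    Le R (OrbitTerm.shift k x) (OrbitTerm.shift k y) := by
  induction h with
  | base h => exact .base h
  | shift l hl h =>
    refine .shift l hl ?_
    rw [h, shift_shift, shift_shift, add_comm]
  | left j hle hne h ihle ih =>
    exact .left j ihle (fun i e => hne i (shift_injective k e)) ih
  | right i h ih => exact .right i ih

theorem Le.map_rename {S : ℕ → ℕ → Prop} {σ : ℕ → ℕ} (hσ : Function.Injective σ)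
    (hRS : ∀ i j, R i j → S (σ i) (σ j)) {x y : OrbitTerm} (h : Le R x y) :
    Le S (rename σ x) (rename σ y) := by
  obtain ⟨τ, hτ⟩ := hσ.hasLeftInverse
  induction h with
  | base h => exact .base (hRS _ _ h)
  | shift l hl h => exact .shift l hl (by rw [h, rename_shift])
  | left j hle hne h ihle ih =>
    exact .left j ihle (fun i e => hne i (Function.LeftInverse.injective (rename_rename hτ) e)) ih
  | right i h ih => exact .right i ih

theorem le_base_base (hR : IsPartialOrder ℕ R) {i j : ℕ} :
    Le R (base i) (base j) ↔ R i j := by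
  refine ⟨fun h => ?_, .base⟩
  cases h with
  | base h => exact h
  | shift k hk h =>
    cases h
    exact hR.refl _

/-- Cut elimination, by induction on the total rank. In the critical case `y = ext p A B w` is
entered through `A i` and left through `B j`; the premise of `Le.left` supplies `A i ≤ B j`, so that
`y` can be bypassed. -/
theorem Le.trans (hR : IsPartialOrder ℕ R) {x y z : OrbitTerm} (hxy : Le R x y)
    (hyz : Le R y z) : Le R x z := by
  induction hN : rank x + rank y + rank z using Nat.strong_induction_on generalizing x y z with
  | _ N ih =>
    subst hN
    cases hxy with
    | @left p m n A B w y j hle hne h =>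
      exact .left j hle hne (ih _ (by have := rank_right_lt p A B w j; omega) h hyz rfl)
    | base h =>
      cases hyz with
      | base h' => exact .base (hR.trans _ _ _ h h')
      | shift k hk h' => exact h' ▸ .base h
      | @right p m n A B w _ i h' =>
        exact .right i (ih _ (by have := rank_left_lt p A B w i; omega) (.base h) h' rfl)
    | shift k hk h =>
      cases hyz with
      | base h' =>
        cases x with
        | base =>
          cases h
          exact .base h'
        | ext => cases h
      | shift l hl h' =>
        exact .shift (k + l) (add_nonneg hk hl) (by rw [h', h, shift_shift])
      | @right p m n A B w _ i h' =>
        exact .right i (ih _ (by have := rank_left_lt p A B w i; omega) (.shift k hk h) h' rfl)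
      | @left p m n A B w _ j hle hne h' =>
        cases x with
        | base => cases h
        | @ext q m' n' A' B' w' =>
          cases h
          have hsh := shift_injective k
          -- The premises on the shifted neighbours are shifted back by `-k`.
          refine .left j (fun i => ?_) (fun i e => hne i (congrArg _ e)) (ih _ ?_
            (.shift k hk rfl) h' rfl)
          · have := (hle i).map_shift (-k)
            simpa [shift_shift, shift_zero] using this
          · have := rank_right_lt p A' B' w' j
            have : rank (OrbitTerm.shift k (B' j)) < _ :=
              rank_right_lt p (fun i => OrbitTerm.shift k (A' i))
                (fun i => OrbitTerm.shift k (B' i)) (w' + k) j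
            omega
    | @right p m n A B w _ i h =>
      cases hyz with
      | shift k hk h' =>
        subst h'
        refine .right (A := fun i => OrbitTerm.shift k (A i)) i
          (ih _ ?_ h (.shift k hk rfl) rfl)
        have := rank_left_lt p A B w i
        rw [rank_shift, rank_shift]
        omega
      | @right p' m' n' A' B' w' _ i' h' =>
        exact .right i' (ih _ (by have := rank_left_lt p' A' B' w' i'; omega) (.right i h) h' rfl)
      | left j hle hne h' =>
        have := rank_left_add_rank_right_lt p A B w i j
        exact ih _ (by omega) h (ih _ (by omega) (hle i) h' rfl) rfl

/-- Shifts preserve rank and `Le.left` passes to a term of smaller rank, so a derivation from a term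
of lower rank must enter the new point through some `A i`. -/
theorem Le.exists_left {x : OrbitTerm} {p m n : ℕ} {A : Fin m → OrbitTerm}
    {B : Fin n → OrbitTerm} {z : ℤ} (h : Le R x (ext p A B z))
    (hr : rank x < rank (ext p A B z)) : ∃ i, Le R x (A i) := by
  generalize hy : ext p A B z = y at h hr
  induction h with
  | base => cases hy
  | shift k hk h => simp [h, rank_shift] at hr
  | @left p m n A B w y j hle hne h ihle ih =>
    obtain ⟨i, hi⟩ := ih hy ((rank_right_lt p A B w j).trans hr)
    exact ⟨i, .left j hle hne hi⟩
  | right i h =>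
    cases hy
    exact ⟨i, h⟩

theorem Le.exists_right {y : OrbitTerm} {p m n : ℕ} {A : Fin m → OrbitTerm}
    {B : Fin n → OrbitTerm} {z : ℤ} (h : Le R (ext p A B z) y)
    (hr : rank y < rank (ext p A B z)) :
    ∃ j, (∀ i, Le R (A i) (B j) ∧ A i ≠ B j) ∧ Le R (B j) y := by
  generalize hx : ext p A B z = x at h hr
  induction h with
  | base => cases hx
  | shift k hk h => simp [h, rank_shift] at hr
  | left j hle hne h =>
    cases hx
    exact ⟨j, fun i => ⟨hle i, hne i⟩, h⟩
  | @right p m n A B w y i h ih =>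
    obtain ⟨j, hj, h'⟩ := ih hx ((rank_left_lt p A B w i).trans hr)
    exact ⟨j, hj, .right i h'⟩

/-- A cycle through a new point and one of its neighbours interpolates to `A i ≤ B j ≤ A i` at
smaller rank, against `A i ≠ B j`. What remains are cycles of base relations and of shifts. -/
theorem Le.antisymm (hR : IsPartialOrder ℕ R) {x y : OrbitTerm} (hxy : Le R x y)
    (hyx : Le R y x) : x = y := by
  induction hN : rank x + rank y using Nat.strong_induction_on generalizing x y with
  | _ N ih =>
    subst hN
    have not_right : ∀ {p m n : ℕ} {A : Fin m → OrbitTerm} {B : Fin n → OrbitTerm} {z : ℤ}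
        {j : Fin n}, rank (ext p A B z) ≤ rank x + rank y → (∀ i, Le R (A i) (B j)) →
        (∀ i, A i ≠ B j) → ¬ Le R (B j) (ext p A B z) := by
      intro p m n A B z j hr hle hne h
      obtain ⟨i, hi⟩ := h.exists_left (rank_right_lt p A B z j)
      have := rank_left_add_rank_right_lt p A B z i j
      exact hne i (ih _ (by omega) (hle i) hi rfl)
    have not_left : ∀ {p m n : ℕ} {A : Fin m → OrbitTerm} {B : Fin n → OrbitTerm} {z : ℤ}
        {i : Fin m}, rank (ext p A B z) ≤ rank x + rank y → ¬ Le R (ext p A B z) (A i) := by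
      intro p m n A B z i hr h
      obtain ⟨j, hj, hji⟩ := h.exists_right (rank_left_lt p A B z i)
      have := rank_left_add_rank_right_lt p A B z i j
      exact (hj i).2 (ih _ (by omega) (hj i).1 hji rfl)
    cases hxy with
    | left j hle hne h => exact (not_right (by omega) hle hne (h.trans hR hyx)).elim
    | right i h => exact (not_left (by omega) (hyx.trans hR h)).elim
    | base h =>
      rw [hR.antisymm _ _ h ((le_base_base hR).1 hyx)]
    | shift k hk h =>
      cases hyx with
      | left j hle hne h' =>
        exact (not_right (by omega) hle hne (h'.trans hR (.shift k hk h))).elim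
      | right i h' =>
        exact (not_left (by omega) (Le.trans hR (.shift k hk h) h')).elim
      | base h' =>
        cases h
        rfl
      | shift l hl h' =>
        cases x with
        | base => exact h.symm
        | ext p A B z =>
          -- Returning to the same integer label forces `k + l = 0`, and both are nonnegative.
          have hkl : k = 0 := by
            rw [h, shift_shift] at h'
            simp only [OrbitTerm.shift, ext.injEq] at h'
            omega
          rw [h, hkl, shift_zero]

theorem Le.isPartialOrder (hR : IsPartialOrder ℕ R) : IsPartialOrder OrbitTerm (Le R) where
  refl := Le.refl
  trans _ _ _ := Le.trans hR
  antisymm _ _ := Le.antisymm hR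

/-- The label `p` is a bound for the ranks in `C`, so `ext p A B 0` outranks all of `C`. By
interpolation, a relation to some `c` would pass through `A` or `B`, which the hypotheses exclude.
-/
theorem hasExtensions (R : ℕ → ℕ → Prop) : HasExtensions (Le R) := by
  intro A B C hA hB hC hAB hAC hBC
  obtain ⟨m, A, hA', rfl⟩ := hA.fin_param
  obtain ⟨n, B, hB', rfl⟩ := hB.fin_param
  simp only [Set.forall_mem_range] at *
  obtain ⟨p, hp⟩ := (hC.image rank).bddAbove
  have hlt : ∀ c ∈ C, rank c < rank (ext p A B 0) := by
    intro c hc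
    have : rank c ≤ p := hp ⟨c, hc, rfl⟩
    simp only [rank]
    omega
  refine ⟨ext p A B 0, fun i => ⟨.right i (.refl _), fun e => ?_⟩, fun j => ⟨.left j
    (fun i => (hAB i j).1) (fun i => (hAB i j).2) (.refl _), fun e => ?_⟩,
    fun c hc => ⟨fun h => ?_, fun h => ?_⟩⟩
  · exact (rank_left_lt p A B 0 i).ne (congrArg rank e)
  · exact (rank_right_lt p A B 0 j).ne' (congrArg rank e)
  · obtain ⟨i, hi⟩ := h.exists_left (hlt c hc)
    exact hAC i c hc hi
  · obtain ⟨j, -, hj⟩ := h.exists_right (hlt c hc)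
    exact hBC j c hc hj

theorem le_ext_iff {x : OrbitTerm} {p m n : ℕ} {A : Fin m → OrbitTerm} {B : Fin n → OrbitTerm}
    {z : ℤ} : Le R x (ext p A B z) ↔ (∃ k, 0 ≤ k ∧ ext p A B z = shift k x) ∨
      (∃ i, Le R x (A i)) ∨ match x with
      | base _ => False
      | @ext _ m' n' A' B' _ => ∃ j : Fin n',
        (∀ i : Fin m', Le R (A' i) (B' j) ∧ A' i ≠ B' j) ∧ Le R (B' j) (ext p A B z) := by
  constructor
  · intro h
    cases h with
    | shift k hk h => exact .inl ⟨k, hk, h⟩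
    | left j hle hne h => exact .inr (.inr ⟨j, fun i => ⟨hle i, hne i⟩, h⟩)
    | right i h => exact .inr (.inl ⟨i, h⟩)
  · rintro (⟨k, hk, h⟩ | ⟨i, h⟩ | h)
    · exact .shift k hk h
    · exact .right i h
    · cases x with
      | base => exact h.elim
      | ext =>
        obtain ⟨j, hj, h⟩ := h
        exact .left j (fun i => (hj i).1) (fun i => (hj i).2) h

theorem ext_le_base_iff {k p m n : ℕ} {A : Fin m → OrbitTerm} {B : Fin n → OrbitTerm} {z : ℤ} :
    Le R (ext p A B z) (base k) ↔
      ∃ j, (∀ i, Le R (A i) (B j) ∧ A i ≠ B j) ∧ Le R (B j) (base k) := by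
  constructor
  · intro h
    exact h.exists_right (by simp only [rank]; omega)
  · rintro ⟨j, hj, h⟩
    exact .left j (fun i => (hj i).1) (fun i => (hj i).2) h

/-- Unfolding one step expresses `Le R x y` by countably many comparisons of smaller total rank and
conditions free of `R`; on base points it is `R` itself. -/
theorem measurableSet_le (x y : OrbitTerm) :
    MeasurableSet {R : CountablePartialOrder | Le R.1 x y} := by
  induction hN : rank x + rank y using Nat.strong_induction_on generalizing x y with
  | _ N ih =>
    subst hN
    rw [measurableSet_setOfPred]
    have ih' : ∀ x' y', rank x' + rank y' < rank x + rank y →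
        Measurable fun R : CountablePartialOrder => Le R.1 x' y' := fun x' y' h =>
      measurableSet_setOfPred.1 (ih _ h x' y' rfl)
    cases y with
    | base j =>
      cases x with
      | base i =>
        have : (fun R : CountablePartialOrder => Le R.1 (base i) (base j)) = fun R => R.1 i j :=
          funext fun R => propext (le_base_base R.2)
        rw [this]
        exact (measurable_pi_apply j).comp ((measurable_pi_apply i).comp measurable_subtype_coe)
      | ext p A B z =>
        simp only [ext_le_base_iff]
        refine Measurable.exists fun l => .and (.forall fun i => .and (ih' _ _ ?_)
          measurable_const) (ih' _ _ ?_)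
        · have := rank_left_add_rank_right_lt p A B z i l
          omega
        · have := rank_right_lt p A B z l
          omega
    | ext p A B z =>
      rw [show (fun R : CountablePartialOrder => Le R.1 x (ext p A B z)) = _ from
        funext fun R => propext le_ext_iff]
      refine .or measurable_const (.or (.exists fun i => ih' _ _ ?_) ?_)
      · have := rank_left_lt p A B z i
        omega
      · cases x with
        | base => exact measurable_const
        | ext q A' B' z' =>
          refine Measurable.exists fun l => .and (.forall fun i => .and (ih' _ _ ?_)
            measurable_const) (ih' _ _ ?_)
          · have := rank_left_add_rank_right_lt q A' B' z' i l
            omega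
          · have := rank_right_lt q A' B' z' l
            omega

end OrbitTerm

/-! ### Coding structures by partial orders -/

/-- The points of the partial order that codes a structure: a chain `marker n`, points
`elt k j` for the element `k` and the coordinate `j - 1`, and points for the tuples. -/
inductive CodePoint {ι : Type} (ar : ι → ℕ) : Type
  | marker (n : ℕ) : CodePoint ar
  | elt (k j : ℕ) : CodePoint ar
  | tuple (i : ι) (v : Fin (ar i) → ℕ) : CodePoint ar

namespace CodePoint

variable {ι : Type} {ar : ι → ℕ}

instance [Countable ι] : Countable (CodePoint ar) := by
  let f : CodePoint ar → ℕ ⊕ (ℕ × ℕ) ⊕ (Σ i, Fin (ar i) → ℕ)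
    | marker n => .inl n
    | elt k j => .inr (.inl (k, j))
    | tuple i v => .inr (.inr ⟨i, v⟩)
  have hf : Function.Injective f := by
    rintro (m | ⟨k, j⟩ | ⟨i, v⟩) (m' | ⟨k', j'⟩ | ⟨i', v'⟩) h <;> simp_all [f]
  exact hf.countable

instance : Infinite (CodePoint ar) :=
  Infinite.of_injective marker fun m n h => by simpa using h

/-- The number of markers below a point for a tuple of the `i`-th relation. -/
def tupleLevel (c : ι → ℕ) (i : ι) : ℕ := 2 * Nat.pair (c i) (ar i) + 1

/-- The partial order that codes a structure. -/
def Le (c : ι → ℕ) (A : CodedStructure ar) : CodePoint ar → CodePoint ar → Prop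
  | marker m, marker n => m ≤ n
  | marker m, elt _ j => m < 2 * j
  | marker m, tuple i v => A i v ∧ m < tupleLevel (ar := ar) c i
  | elt k j, elt k' j' => k = k' ∧ (j = j' ∨ j = 0)
  | elt k j, tuple i v => A i v ∧ ∃ q : Fin (ar i), (j = 0 ∨ j = (q : ℕ) + 1) ∧ v q = k
  | tuple i v, tuple i' v' => tuple i v = tuple (ar := ar) i' v'
  | _, _ => False

theorem isPartialOrder_le (c : ι → ℕ) (A : CodedStructure ar) :
    IsPartialOrder (CodePoint ar) (Le c A) where
  refl := by rintro (m | ⟨k, j⟩ | ⟨i, v⟩) <;> simp [Le]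
  antisymm := by
    rintro (m | ⟨k, j⟩ | ⟨i, v⟩) (m' | ⟨k', j'⟩ | ⟨i', v'⟩) <;> simp only [Le] <;> grind
  trans := by
    rintro (m | ⟨k, j⟩ | ⟨i, v⟩) (m' | ⟨k', j'⟩ | ⟨i', v'⟩) (m'' | ⟨k'', j''⟩ | ⟨i'', v''⟩) h h'
    case marker.elt.tuple =>
      obtain ⟨hA, q, hq, -⟩ := h'
      refine ⟨hA, ?_⟩
      -- The arity enters `tupleLevel` for this: a coordinate point below the tuple has `j ≤ ar i`,
      -- so the markers below it, those under `2 * j`, are also below the tuple.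
      have := Nat.right_le_pair (c i'') (ar i'')
      simp only [Le] at h
      simp only [tupleLevel]
      omega
    case elt.tuple.tuple =>
      cases h'
      exact h
    all_goals simp only [Le] at h h' ⊢
    all_goals grind

theorem measurable_le (c : ι → ℕ) (x y : CodePoint ar) :
    Measurable fun A : CodedStructure ar => Le c A x y := by
  have hA : ∀ i v, Measurable fun A : CodedStructure ar => A i v := fun i v =>
    (measurable_pi_apply v).comp (measurable_pi_apply i)
  rcases x with m | ⟨k, j⟩ | ⟨i, v⟩ <;> rcases y with m' | ⟨k', j'⟩ | ⟨i', v'⟩ <;>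
    simp only [Le] <;>
    first
      | exact measurable_const
      | exact (hA _ _).and measurable_const

/-- Renaming of the elements. -/
def rename (σ : ℕ → ℕ) : CodePoint ar → CodePoint ar
  | marker n => marker n
  | elt k j => elt (σ k) j
  | tuple i v => tuple i (fun q => σ (v q))

theorem le_rename {c : ι → ℕ} {A B : CodedStructure ar} (σ : ℕ ≃ ℕ)
    (h : ∀ (i : ι) (v : Fin (ar i) → ℕ), A i v ↔ B i (fun q => σ (v q))) (x y : CodePoint ar) :
    Le c B (rename σ x) (rename σ y) ↔ Le c A x y := by
  rcases x with m | ⟨k, j⟩ | ⟨i, v⟩ <;> rcases y with m' | ⟨k', j'⟩ | ⟨i', v'⟩ <;>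
    simp only [Le, rename, ← h, σ.injective.eq_iff]
  constructor
  · intro e
    injection e with e1 e2
    subst e1
    rw [funext fun q => σ.injective (congrFun (eq_of_heq e2) q)]
  · intro e
    injection e with e1 e2
    subst e1
    rw [eq_of_heq e2]

/-- The points that begin a chain of four points are the markers. -/
def IsMarker (r : CodePoint ar → CodePoint ar → Prop) (x : CodePoint ar) : Prop :=
  ∃ y z w, (r x y ∧ x ≠ y) ∧ (r y z ∧ y ≠ z) ∧ (r z w ∧ z ≠ w)

/-- Above a point that is not a marker, the longest chains have three points: `elt k 0`, `elt k j`,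
then a tuple. -/
theorem isMarker_le_iff {c : ι → ℕ} {A : CodedStructure ar} {x : CodePoint ar} :
    IsMarker (Le c A) x ↔ ∃ n, x = marker n := by
  constructor
  · rintro ⟨y, z, w, ⟨h1, n1⟩, ⟨h2, n2⟩, ⟨h3, n3⟩⟩
    rcases x with m | ⟨k, j⟩ | ⟨i, v⟩
    · exact ⟨m, rfl⟩
    · exfalso
      rcases y with m1 | ⟨k1, j1⟩ | ⟨i1, v1⟩ <;> rcases z with m2 | ⟨k2, j2⟩ | ⟨i2, v2⟩ <;>
        rcases w with m3 | ⟨k3, j3⟩ | ⟨i3, v3⟩ <;> simp only [Le] at h1 h2 h3 <;> grind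
    · exfalso
      rcases y with m1 | ⟨k1, j1⟩ | ⟨i1, v1⟩ <;> simp only [Le] at h1
      exact n1 h1
  · rintro ⟨n, rfl⟩
    exact ⟨marker (n + 1), marker (n + 2), marker (n + 3), by simp [Le]⟩

/-- The number of markers below a point. -/
noncomputable def level (r : CodePoint ar → CodePoint ar → Prop) (x : CodePoint ar) : ℕ :=
  {y | IsMarker r y ∧ r y x}.ncard

theorem level_eq {c : ι → ℕ} {A : CodedStructure ar} {x : CodePoint ar} {N : ℕ}
    (h : ∀ m, Le c A (marker m) x ↔ m < N) : level (Le c A) x = N := by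
  have : {y | IsMarker (Le c A) y ∧ Le c A y x} = marker '' (Finset.range N : Set ℕ) := by
    ext y
    simp only [isMarker_le_iff, Set.mem_ofPred_eq, Set.mem_image, Finset.coe_range, Set.mem_Iio]
    constructor
    · rintro ⟨⟨m, rfl⟩, hm⟩
      exact ⟨m, (h m).1 hm, rfl⟩
    · rintro ⟨m, hm, rfl⟩
      exact ⟨⟨m, rfl⟩, (h m).2 hm⟩
  rw [level, this, Set.ncard_image_of_injective _ fun m n h => by simpa using h,
    Set.ncard_coe_finset, Finset.card_range]

theorem level_elt (c : ι → ℕ) (A : CodedStructure ar) (k j : ℕ) :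
    level (Le c A) (elt k j) = 2 * j :=
  level_eq fun _ => Iff.rfl

theorem level_tuple_of_mem {c : ι → ℕ} {A : CodedStructure ar} {i : ι} {v : Fin (ar i) → ℕ}
    (h : A i v) : level (Le c A) (tuple i v) = tupleLevel (ar := ar) c i :=
  level_eq fun _ => by simp [Le, h]

theorem level_tuple_of_notMem {c : ι → ℕ} {A : CodedStructure ar} {i : ι} {v : Fin (ar i) → ℕ}
    (h : ¬ A i v) : level (Le c A) (tuple i v) = 0 :=
  level_eq fun _ => by simp [Le, h]

theorem isMarker_relIso {r s : CodePoint ar → CodePoint ar → Prop} (h : r ≃r s)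
    (x : CodePoint ar) : IsMarker s (h x) ↔ IsMarker r x := by
  simp only [IsMarker]
  rw [← h.toEquiv.exists_congr_right]
  refine exists_congr fun y => ?_
  rw [← h.toEquiv.exists_congr_right]
  refine exists_congr fun z => ?_
  rw [← h.toEquiv.exists_congr_right]
  refine exists_congr fun w => ?_
  simp [h.map_rel_iff]

theorem level_relIso {r s : CodePoint ar → CodePoint ar → Prop} (h : r ≃r s)
    (x : CodePoint ar) : level s (h x) = level r x := by
  have : {y | IsMarker s y ∧ s y (h x)} = h '' {y | IsMarker r y ∧ r y x} := by
    ext y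
    obtain ⟨y, rfl⟩ := h.surjective y
    simp [isMarker_relIso, h.map_rel_iff]
  rw [level, this, Set.ncard_image_of_injective _ h.injective, level]

theorem exists_elt_of_level {c : ι → ℕ} {A : CodedStructure ar} {x : CodePoint ar} {j : ℕ}
    (hx : ¬ IsMarker (Le c A) x) (h : level (Le c A) x = 2 * (j + 1)) :
    ∃ k, x = elt k (j + 1) := by
  rcases x with m | ⟨k, l⟩ | ⟨i, v⟩
  · exact (hx (isMarker_le_iff.2 ⟨m, rfl⟩)).elim
  · rw [level_elt] at h
    have : l = j + 1 := by omega
    exact ⟨k, by rw [this]⟩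
  · by_cases hv : A i v
    · rw [level_tuple_of_mem hv, tupleLevel] at h
      omega
    · rw [level_tuple_of_notMem hv] at h
      omega

theorem exists_tuple_of_level {c : ι → ℕ} (hc : Function.Injective c) {A : CodedStructure ar}
    {x : CodePoint ar} {i : ι} (hx : ¬ IsMarker (Le c A) x)
    (h : level (Le c A) x = tupleLevel (ar := ar) c i) : ∃ v, A i v ∧ x = tuple i v := by
  rcases x with m | ⟨k, l⟩ | ⟨i', v⟩
  · exact (hx (isMarker_le_iff.2 ⟨m, rfl⟩)).elim
  · rw [level_elt, tupleLevel] at h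
    omega
  · by_cases hv : A i' v
    · rw [level_tuple_of_mem hv, tupleLevel, tupleLevel] at h
      have h' : Nat.pair (c i') (ar i') = Nat.pair (c i) (ar i) := by omega
      obtain rfl := hc (Nat.pair_eq_pair.1 h').1
      exact ⟨v, hv, rfl⟩
    · rw [level_tuple_of_notMem hv, tupleLevel] at h
      omega

theorem exists_map_elt {c : ι → ℕ} {A B : CodedStructure ar} (h : Le c A ≃r Le c B) :
    ∃ σ : ℕ → ℕ, ∀ k j, h (elt k j) = elt (σ k) j := by
  have hm : ∀ k j, ¬ IsMarker (Le c B) (h (elt k j)) := by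
    intro k j
    rw [isMarker_relIso, isMarker_le_iff]
    rintro ⟨n, hn⟩
    cases hn
  have h1 : ∀ k j, ∃ k', h (elt k (j + 1)) = elt k' (j + 1) := fun k j =>
    exists_elt_of_level (hm _ _) (by rw [level_relIso, level_elt])
  -- Level `0` also belongs to the isolated points of tuples outside the relation. Lying below a
  -- point `elt k' 1` rules these out.
  have h0 : ∀ k, ∃ k', h (elt k 0) = elt k' 0 := by
    intro k
    obtain ⟨k', hk'⟩ := h1 k 0
    have hle : Le c B (h (elt k 0)) (h (elt k 1)) := h.map_rel_iff.2 ⟨rfl, .inr rfl⟩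
    have hl := level_relIso h (elt k 0)
    have hm' := hm k 0
    rw [hk'] at hle
    rw [level_elt] at hl
    generalize h (elt k 0) = y at hle hl hm'
    rcases y with m | ⟨l, j⟩ | ⟨i, v⟩
    · exact (hm' (isMarker_le_iff.2 ⟨m, rfl⟩)).elim
    · rw [level_elt] at hl
      exact ⟨l, by rw [show j = 0 by omega]⟩
    · exact hle.elim
  choose σ hσ using h0
  refine ⟨σ, fun k j => ?_⟩
  cases j with
  | zero => exact hσ k
  | succ j =>
    obtain ⟨k', hk'⟩ := h1 k j
    have hle : Le c B (h (elt k 0)) (h (elt k (j + 1))) := h.map_rel_iff.2 ⟨rfl, .inr rfl⟩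
    rw [hσ, hk'] at hle
    rw [hk', hle.1]

/-- The level determines the relation symbol, and the points `elt (v q) (q + 1)` below the tuple
determine its coordinates in order. -/
theorem holds_of_map_elt {c : ι → ℕ} (hc : Function.Injective c) {A B : CodedStructure ar}
    (h : Le c A ≃r Le c B) {σ : ℕ → ℕ} (hσ : ∀ k j, h (elt k j) = elt (σ k) j) {i : ι}
    {v : Fin (ar i) → ℕ} (hv : A i v) : B i fun q => σ (v q) := by
  obtain ⟨w, hw, hvw⟩ := exists_tuple_of_level (c := c) hc (A := B) (x := h (tuple i v)) (i := i)
    (by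
      rw [isMarker_relIso, isMarker_le_iff]
      rintro ⟨n, hn⟩
      cases hn)
    (by rw [level_relIso, level_tuple_of_mem hv])
  have : w = fun q => σ (v q) := by
    funext q
    have hle : Le c B (h (elt (v q) (q + 1))) (h (tuple i v)) :=
      h.map_rel_iff.2 ⟨hv, q, .inr rfl, rfl⟩
    rw [hσ, hvw] at hle
    obtain ⟨-, q', hq, hq'⟩ := hle
    have : q' = q := Fin.ext (by omega)
    rw [← hq', this]
  rwa [← this]

theorem iso_of_relIso {c : ι → ℕ} (hc : Function.Injective c) {A B : CodedStructure ar}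
    (h : Le c A ≃r Le c B) : CodedStructure.iso ar A B := by
  obtain ⟨σ, hσ⟩ := exists_map_elt h
  obtain ⟨τ, hτ⟩ := exists_map_elt h.symm
  have hτσ : ∀ k, τ (σ k) = k := fun k => by
    have := h.symm_apply_apply (elt k 0)
    rw [hσ, hτ] at this
    injection this
  have hστ : ∀ k, σ (τ k) = k := fun k => by
    have := h.apply_symm_apply (elt k 0)
    rw [hτ, hσ] at this
    injection this
  refine ⟨⟨σ, τ, hτσ, hστ⟩, fun i v => ⟨holds_of_map_elt hc h hσ, fun hv => ?_⟩⟩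
  have := holds_of_map_elt hc h.symm hτ hv
  simpa [hτσ] using this

theorem nonempty_relIso_iff {c : ι → ℕ} (hc : Function.Injective c) {A B : CodedStructure ar} :
    Nonempty (Le c A ≃r Le c B) ↔ CodedStructure.iso ar A B := by
  refine ⟨fun ⟨h⟩ => iso_of_relIso hc h, fun ⟨σ, h⟩ => ⟨⟨⟨rename σ, rename σ.symm, ?_, ?_⟩,
    fun {x y} => le_rename σ h x y⟩⟩⟩
  · rintro (m | ⟨k, j⟩ | ⟨i, v⟩) <;> simp [rename]
  · rintro (m | ⟨k, j⟩ | ⟨i, v⟩) <;> simp [rename]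

end CodePoint

/-- The isomorphism relation on every class of countable structures is Borel reducible to the
isomorphism relation on countable partial orders. -/
theorem StructureClass.borelReducible_countablePartialOrder {ι : Type} [Countable ι] {ar : ι → ℕ}
    (C : StructureClass ar) : BorelReducible C.iso CountablePartialOrder.iso := by
  obtain ⟨c, hc⟩ := exists_injective_nat ι
  obtain ⟨e⟩ : Nonempty (ℕ ≃ CodePoint ar) := nonempty_equiv_of_countable
  have hpo : ∀ A, IsPartialOrder ℕ fun m n => CodePoint.Le c A (e m) (e n) := fun A =>
    have h := CodePoint.isPartialOrder_le c A
    { refl := fun m => h.refl _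
      trans := fun _ _ _ => h.trans _ _ _
      antisymm := fun _ _ h1 h2 => e.injective (h.antisymm _ _ h1 h2) }
  let ei : ∀ A : CodedStructure ar,
      (fun m n => CodePoint.Le c A (e m) (e n)) ≃r CodePoint.Le c A := fun A => ⟨e, Iff.rfl⟩
  refine ⟨fun A => ⟨_, hpo A.1⟩, Measurable.subtype_mk ?_, fun A B => ?_⟩
  · exact measurable_pi_iff.2 fun m => measurable_pi_iff.2 fun n =>
      (CodePoint.measurable_le c (e m) (e n)).comp measurable_subtype_coe
  · change CodedStructure.iso ar A.1 B.1 ↔ Nonempty (_ ≃r _)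
    rw [← CodePoint.nonempty_relIso_iff hc]
    exact ⟨fun ⟨h⟩ => ⟨((ei A.1).trans h).trans (ei B.1).symm⟩,
      fun ⟨h⟩ => ⟨((ei A.1).symm.trans h).trans (ei B.1)⟩⟩

/-! ### The shift on `P`: orbits, fixed points and conjugacy -/

namespace OrbitTerm

variable {R S : ℕ → ℕ → Prop} {P : Type*} [PartialOrder P]

theorem le_shift_iff (k : ℤ) {x y : OrbitTerm} : Le R (shift k x) (shift k y) ↔ Le R x y := by
  refine ⟨fun h => ?_, fun h => h.map_shift k⟩
  simpa [shift_shift, shift_zero] using h.map_shift (-k)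

theorem le_rename_iff (σ : R ≃r S) {x y : OrbitTerm} :
    Le S (rename σ x) (rename σ y) ↔ Le R x y := by
  refine ⟨fun h => ?_, fun h => h.map_rename σ.injective fun i j => σ.map_rel_iff.2⟩
  have := h.map_rename σ.symm.injective fun i j => σ.symm.map_rel_iff.2
  rwa [rename_rename σ.symm_apply_apply, rename_rename σ.symm_apply_apply] at this

/-- The automorphism of `P` given by an isomorphism of the terms with `P` and a power of the
shift. -/
def shiftIso (e : OrbitTerm ≃ P) (he : ∀ x y, Le R x y ↔ e x ≤ e y) : P ≃o P where
  toFun p := e (shift 1 (e.symm p))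
  invFun p := e (shift (-1) (e.symm p))
  left_inv p := by simp [shift_shift, shift_zero]
  right_inv p := by simp [shift_shift, shift_zero]
  map_rel_iff' {p q} := by
    change e _ ≤ e _ ↔ _
    rw [← he, le_shift_iff, he, e.apply_symm_apply, e.apply_symm_apply]

section

variable {e : OrbitTerm ≃ P} {he : ∀ x y, Le R x y ↔ e x ≤ e y}

theorem shiftIso_apply (x : OrbitTerm) : shiftIso e he (e x) = e (shift 1 x) := by
  change e (shift 1 (e.symm (e x))) = _
  rw [e.symm_apply_apply]

theorem shiftIso_inv_apply (x : OrbitTerm) : (shiftIso e he)⁻¹ (e x) = e (shift (-1) x) := by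
  change e (shift (-1) (e.symm (e x))) = _
  rw [e.symm_apply_apply]

theorem shiftIso_zpow_apply (n : ℤ) (x : OrbitTerm) :
    (shiftIso e he ^ n) (e x) = e (shift n x) := by
  induction n generalizing x with
  | zero => simp [shift_zero]
  | succ n ih => rw [zpow_add_one, RelIso.mul_apply, shiftIso_apply, ih, shift_shift, add_comm]
  | pred n ih =>
    rw [zpow_sub_one, RelIso.mul_apply, shiftIso_inv_apply, ih, shift_shift, sub_eq_add_neg,
      add_comm]

theorem shift_one_ext_ne (p : ℕ) {m n : ℕ} (A : Fin m → OrbitTerm) (B : Fin n → OrbitTerm)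
    (z : ℤ) : shift 1 (ext p A B z) ≠ ext p A B z := by
  intro h
  injection h
  omega

theorem autOrbit_shiftIso_base (k : ℕ) : autOrbit (shiftIso e he) (e (base k)) = {e (base k)} := by
  ext p
  simp only [autOrbit, Set.mem_range, shiftIso_zpow_apply, Set.mem_singleton_iff]
  exact ⟨fun ⟨_, h⟩ => h.symm, fun h => ⟨0, h.symm⟩⟩

/-- The orbit of a new term contains that term and its shift, which are distinct and comparable. -/
theorem exists_base_of_isAntichain {x : OrbitTerm}
    (h : IsAntichain (· ≤ ·) (autOrbit (shiftIso e he) (e x))) : ∃ k, x = base k := by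
  cases x with
  | base k => exact ⟨k, rfl⟩
  | ext p A B z =>
    refine (shift_one_ext_ne p A B z (e.injective ?_)).elim
    refine (h.eq ⟨0, shiftIso_zpow_apply _ _⟩ ⟨1, shiftIso_zpow_apply _ _⟩ ?_).symm.trans ?_
    · exact (he _ _).1 (.shift 1 zero_le_one (by rw [shift_zero]))
    · rw [shift_zero]

variable (he) in
theorem nonempty_relIso_antichainOrbitLE (hR : IsPartialOrder ℕ R) :
    Nonempty (R ≃r antichainOrbitLE (shiftIso e he)) := by
  let f : ℕ → AntichainOrbit (shiftIso e he) := fun k =>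
    ⟨autOrbit (shiftIso e he) (e (base k)), ⟨_, rfl⟩, by
      rw [autOrbit_shiftIso_base]
      exact IsAntichain.singleton⟩
  have hf : Function.Bijective f := by
    constructor
    · intro i j h
      have := congrArg Subtype.val h
      simpa [f, autOrbit_shiftIso_base] using this
    · rintro ⟨O, ⟨p, rfl⟩, hO⟩
      obtain ⟨x, rfl⟩ := e.surjective p
      obtain ⟨k, rfl⟩ := exists_base_of_isAntichain hO
      exact ⟨k, rfl⟩
  refine ⟨⟨Equiv.ofBijective f hf, fun {i j} => ?_⟩⟩
  simp [antichainOrbitLE, f, autOrbit_shiftIso_base, ← he, le_base_base hR]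

variable (he) in
-- Fixed points are a conjugacy invariant, so this form recovers `R` from the conjugacy class.
theorem nonempty_relIso_fixed (hR : IsPartialOrder ℕ R) :
    Nonempty (R ≃r fun p q : {p : P // shiftIso e he p = p} => p.1 ≤ q.1) := by
  let f : ℕ → {p : P // shiftIso e he p = p} := fun k => ⟨e (base k), shiftIso_apply _⟩
  have hf : Function.Bijective f := by
    constructor
    · intro i j h
      have := congrArg Subtype.val h
      simpa [f] using this
    · rintro ⟨p, hp⟩
      obtain ⟨x, rfl⟩ := e.surjective p
      cases x with
      | base k => exact ⟨k, rfl⟩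
      | ext p A B z =>
        rw [shiftIso_apply] at hp
        exact (shift_one_ext_ne p A B z (e.injective hp)).elim
  refine ⟨⟨Equiv.ofBijective f hf, fun {i j} => ?_⟩⟩
  simp [f, ← he, le_base_base hR]

end

theorem isConj_shiftIso_iff {d e : OrbitTerm ≃ P} (hd : ∀ x y, Le R x y ↔ d x ≤ d y)
    (he : ∀ x y, Le S x y ↔ e x ≤ e y) (hR : IsPartialOrder ℕ R) (hS : IsPartialOrder ℕ S) :
    IsConj (shiftIso d hd) (shiftIso e he) ↔ Nonempty (R ≃r S) := by
  rw [isConj_iff]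
  constructor
  · rintro ⟨g, hg⟩
    rw [mul_inv_eq_iff_eq_mul] at hg
    have hg' : ∀ p, g (shiftIso d hd p) = shiftIso e he (g p) := fun p => DFunLike.congr_fun hg p
    obtain ⟨a⟩ := nonempty_relIso_fixed hd hR
    obtain ⟨b⟩ := nonempty_relIso_fixed he hS
    let c : (fun p q : {p : P // shiftIso d hd p = p} => p.1 ≤ q.1) ≃r
        fun p q : {p : P // shiftIso e he p = p} => p.1 ≤ q.1 :=
      ⟨g.toEquiv.subtypeEquiv fun p => by
        change _ ↔ shiftIso e he (g p) = g p
        rw [← hg', g.injective.eq_iff], g.le_iff_le⟩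
    exact ⟨(a.trans c).trans b.symm⟩
  · rintro ⟨σ⟩
    let ρ : OrbitTerm ≃ OrbitTerm := ⟨rename σ, rename σ.symm, rename_rename σ.left_inv,
      rename_rename σ.right_inv⟩
    let g : P ≃o P := ⟨(d.symm.trans ρ).trans e, fun {p q} => by
      change e (rename σ (d.symm p)) ≤ e (rename σ (d.symm q)) ↔ p ≤ q
      rw [← he, le_rename_iff, hd, d.apply_symm_apply, d.apply_symm_apply]⟩
    have hg : ∀ x, g (d x) = e (rename σ x) := fun x => by
      change e (rename σ (d.symm (d x))) = _
      rw [d.symm_apply_apply]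
    refine ⟨g, mul_inv_eq_iff_eq_mul.2 (DFunLike.ext _ _ fun p => ?_)⟩
    obtain ⟨x, rfl⟩ := d.surjective p
    rw [RelIso.mul_apply, RelIso.mul_apply, shiftIso_apply, hg, hg, shiftIso_apply, rename_shift]

end OrbitTerm

/-! ### Existence, the Borel reduction and completeness -/

theorem exists_isGenericPartialOrder :
    ∃ (P : Type) (_ : PartialOrder P), Countable P ∧ IsGenericPartialOrder P := by
  have h := OrbitTerm.Le.isPartialOrder (isPartialOrder_le ℕ)
  let _ : PartialOrder OrbitTerm :=
    { le := OrbitTerm.Le fun m n => m ≤ n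
      le_refl := h.refl
      le_trans := h.trans
      le_antisymm := h.antisymm }
  exact ⟨OrbitTerm, inferInstance, inferInstance,
    HasExtensions.isGenericPartialOrder (OrbitTerm.hasExtensions _)⟩

theorem measurable_orderIso_iff {X P : Type*} [MeasurableSpace X] [PartialOrder P] [Countable P]
    {f : X → (P ≃o P)} : Measurable f ↔ ∀ p q, MeasurableSet {x | f x p = q} := by
  let _ : MeasurableSpace P := ⊤
  have : DiscreteMeasurableSpace P := ⟨fun _ => trivial⟩
  rw [measurable_comap_iff]
  refine measurable_pi_iff.trans (forall_congr' fun p => ?_)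
  exact ⟨fun h q => h (MeasurableSet.of_discrete (s := {q})), fun h => measurable_to_countable' h⟩

theorem IsGenericPartialOrder.exists_isBorelReduction {P : Type*} [PartialOrder P] [Countable P]
    (h : IsGenericPartialOrder P) :
    ∃ f : CountablePartialOrder → (P ≃o P),
      IsBorelReduction CountablePartialOrder.iso (IsConj.setoid (P ≃o P)) f ∧
      ∀ R : CountablePartialOrder, Nonempty (R.1 ≃r antichainOrbitLE (f R)) := by
  have := h.infinite
  obtain ⟨e, he, -, hm⟩ := exists_measurable_equiv (X := CountablePartialOrder)
    (r := fun R => OrbitTerm.Le R.1) (s := fun x y : P => x ≤ y)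
    (fun R => OrbitTerm.Le.isPartialOrder R.2) (isPartialOrder_le P)
    (fun R => OrbitTerm.hasExtensions R.1) h.hasExtensions OrbitTerm.measurableSet_le (l₀ := [])
    (fun _ => by simp [IsPartialIso])
  refine ⟨fun R => OrbitTerm.shiftIso (e R) (he R), ⟨?_, fun R S => ?_⟩,
    fun R => OrbitTerm.nonempty_relIso_antichainOrbitLE (he R) R.2⟩
  · refine measurable_orderIso_iff.2 fun p q => ?_
    have : {R | OrbitTerm.shiftIso (e R) (he R) p = q} =
        ⋃ x, {R | e R x = p} ∩ {R | e R (OrbitTerm.shift 1 x) = q} := by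
      ext R
      simp only [Set.mem_ofPred_eq, Set.mem_iUnion, Set.mem_inter_iff]
      constructor
      · intro hq
        exact ⟨(e R).symm p, (e R).apply_symm_apply p, hq⟩
      · rintro ⟨x, rfl, rfl⟩
        exact OrbitTerm.shiftIso_apply x
    rw [this]
    exact MeasurableSet.iUnion fun x => (hm _ _).inter (hm _ _)
  · exact (OrbitTerm.isConj_shiftIso_iff (he R) (he S) R.2 S.2).symm

/-- An isomorphism of the structures formed by the order and the graph of the automorphism is the
same as a conjugating automorphism of `P`. -/
theorem exists_borelReducible_structureClass (P : Type*) [PartialOrder P] [Countable P]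
    [Infinite P] : ∃ (ι : Type) (_ : Countable ι) (ar : ι → ℕ) (C : StructureClass ar),
      BorelReducible (IsConj.setoid (P ≃o P)) C.iso := by
  obtain ⟨e⟩ : Nonempty (ℕ ≃ P) := nonempty_equiv_of_countable
  let C : StructureClass (fun _ : Bool => 2) := ⟨Set.univ, MeasurableSet.univ, fun _ _ _ h => h⟩
  let F : (P ≃o P) → CodedStructure (fun _ : Bool => 2) := fun φ b v =>
    (b = true ∧ e (v 0) ≤ e (v 1)) ∨ (b = false ∧ φ (e (v 0)) = e (v 1))
  refine ⟨Bool, inferInstance, fun _ => 2, C, fun φ => ⟨F φ, trivial⟩,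
    Measurable.subtype_mk ?_, fun φ ψ => ?_⟩
  · refine measurable_pi_iff.2 fun b => measurable_pi_iff.2 fun v => ?_
    exact .or measurable_const (.and measurable_const (measurableSet_setOfPred.1
      (measurable_orderIso_iff.1 measurable_id _ _)))
  · change IsConj φ ψ ↔ ∃ σ : ℕ ≃ ℕ, _
    rw [isConj_iff]
    constructor
    · rintro ⟨g, hg⟩
      rw [mul_inv_eq_iff_eq_mul] at hg
      have hg' : ∀ p, g (φ p) = ψ (g p) := fun p => DFunLike.congr_fun hg p
      refine ⟨(e.trans g.toEquiv).trans e.symm, fun b v => ?_⟩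
      simp [F, ← hg']
    · rintro ⟨σ, hσ⟩
      have hle : ∀ m n, e m ≤ e n ↔ e (σ m) ≤ e (σ n) := fun m n => by
        simpa [F] using hσ true ![m, n]
      have hgr : ∀ m n, φ (e m) = e n ↔ ψ (e (σ m)) = e (σ n) := fun m n => by
        simpa [F] using hσ false ![m, n]
      let g : P ≃o P := ⟨(e.symm.trans σ).trans e, fun {p q} => by
        change e (σ (e.symm p)) ≤ e (σ (e.symm q)) ↔ p ≤ q
        rw [← hle, e.apply_symm_apply, e.apply_symm_apply]⟩
      have hg : ∀ m, g (e m) = e (σ m) := fun m => by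
        change e (σ (e.symm (e m))) = _
        rw [e.symm_apply_apply]
      refine ⟨g, mul_inv_eq_iff_eq_mul.2 (DFunLike.ext _ _ fun p => ?_)⟩
      obtain ⟨m, rfl⟩ := e.surjective p
      obtain ⟨n, hn⟩ := e.surjective (φ (e m))
      rw [RelIso.mul_apply, RelIso.mul_apply, hg, (hgr m n).1 hn.symm, ← hn, hg]

theorem BorelReducible.trans {X Y Z : Type*} [MeasurableSpace X] [StandardBorelSpace X]
    [MeasurableSpace Y] [StandardBorelSpace Y] [MeasurableSpace Z] [StandardBorelSpace Z]
    {E : Setoid X} {F : Setoid Y} {G : Setoid Z} (h : BorelReducible E F)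
    (h' : BorelReducible F G) : BorelReducible E G := by
  obtain ⟨f, hf, hEF⟩ := h
  obtain ⟨g, hg, hFG⟩ := h'
  exact ⟨g ∘ f, hg.comp hf, fun x y => (hEF x y).trans (hFG _ _)⟩

theorem theorem2 :
    (∃ (P : Type) (_ : PartialOrder P), Countable P ∧ IsGenericPartialOrder P) ∧
    ∀ (P : Type*) [PartialOrder P] [Countable P], IsGenericPartialOrder P →
      (∃ f : CountablePartialOrder → (P ≃o P),
        IsBorelReduction CountablePartialOrder.iso (IsConj.setoid (P ≃o P)) f ∧
        ∀ R : CountablePartialOrder, Nonempty (R.1 ≃r antichainOrbitLE (f R))) ∧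
      BorelComplete (IsConj.setoid (P ≃o P)) := by
  refine ⟨exists_isGenericPartialOrder, fun P _ _ h => ⟨h.exists_isBorelReduction, ?_⟩⟩
  have := h.infinite
  obtain ⟨f, hf, -⟩ := h.exists_isBorelReduction
  exact ⟨exists_borelReducible_structureClass P, fun ι _ ar C =>
    C.borelReducible_countablePartialOrder.trans ⟨f, hf⟩⟩
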